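/- Let $n$ be a positive integer, let $E_1,\dots,E_n$ and $F$ be Banach spaces over $\mathbb K=\mathbb R$ or $\mathbb C$, and suppose that each $E_k$ has cotype $2$, i.e. there is a constant $C_k\ge 0$ such that for all $m$ and all $x_1,\dots,x_m\in E_k$ $$\Big(\sum_{j=1}^m\|x_j\|^2\Big)^{1/2}\le C_k\Big(2^{-m}\sum_{\varepsilon\in\{-1,1\}^m}\Big\|\sum_{j=1}^m\varepsilon_jx_j\Big\|^2\Big)^{1/2}.$$ For $1\le p<\infty$ and a finite family $(x_j)_{j=1}^m$ in a Banach space $E$ put $$\|(x_j)_{j=1}^m\|_{w,p}=\sup\Big\{\Big(\sum_{j=1}^m|\varphi(x_j)|^p\Big)^{1/p}:\varphi\in E',\ \|\varphi\|\le1\Big\}.$$ A continuous $n$-linear map $A:E_1\times\cdots\times E_n\to F$ is called multiple $p$-summing if there is a constant $C\ge0$ such that $$\Big(\sum_{j_1=1}^{m_1}\cdots\sum_{j_n=1}^{m_n}\big\|A(x^{(1)}_{j_1},\dots,x^{(n)}_{j_n})\big\|^p\Big)^{1/p}\le C\prod_{k=1}^n\big\|(x^{(k)}_j)_{j=1}^{m_k}\big\|_{w,p}$$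 for all $m_1,\dots,m_n\in\mathbb N$ and all $x^{(k)}_j\in E_k$ ($1\le j\le m_k$, $1\le k\le n$); $\Pi_p^n(E_1,\dots,E_n;F)$ denotes the set of all such maps. Then $$\Pi_2^n(E_1,\dots,E_n;F)\subset\Pi_1^n(E_1,\dots,E_n;F).$$ -/

import Mathlib

noncomputable section

/-- `E` has (Rademacher) cotype `q` (`2 ≤ q < ∞`): there is a constant `C` such that, for all finite
families `x₁, …, xₘ`, `(∑ ‖xⱼ‖ ^ q) ^ (1/q) ≤ C (𝔼 ‖∑ εⱼ xⱼ‖²) ^ (1/2)`, where `𝔼` is the average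
over the `2 ^ m` choices of signs `εⱼ ∈ {1, -1}` (that is, `ℤˣ`). -/
def HasCotype (q : ℝ) (E : Type*) [NormedAddCommGroup E] : Prop :=
  ∃ C : ℝ, 0 ≤ C ∧ ∀ (m : ℕ) (x : Fin m → E),
    (∑ j, ‖x j‖ ^ q) ^ (1 / q) ≤
      C * ((∑ ε : Fin m → ℤˣ, ‖∑ j, ((ε j : ℤˣ) : ℤ) • x j‖ ^ (2 : ℝ)) / (2 : ℝ) ^ m) ^
        (1 / 2 : ℝ)

/-- The weak `ℓ_p` norm of a finite family: the supremum of `(∑ |φ (xⱼ)| ^ p) ^ (1/p)` over the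
functionals `φ` in the closed unit ball of the dual of `E`. -/
def weakLpNorm (𝕜 : Type*) [RCLike 𝕜] {E : Type*} [NormedAddCommGroup E] [NormedSpace 𝕜 E]
    (p : ℝ) {m : ℕ} (x : Fin m → E) : ℝ :=
  ⨆ φ : {φ : StrongDual 𝕜 E // ‖φ‖ ≤ 1}, (∑ j, ‖φ.1 (x j)‖ ^ p) ^ (1 / p)

/-- `A` is multiple `(q; p₁, …, pₙ)`-summing (`1 ≤ pₖ ≤ q`). -/
def IsMultipleSumming {𝕜 : Type*} [RCLike 𝕜] {n : ℕ} {E : Fin n → Type*} {F : Type*}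
    [∀ k, NormedAddCommGroup (E k)] [∀ k, NormedSpace 𝕜 (E k)]
    [NormedAddCommGroup F] [NormedSpace 𝕜 F]
    (q : ℝ) (p : Fin n → ℝ) (A : ContinuousMultilinearMap 𝕜 E F) : Prop :=
  ∃ C : ℝ, 0 ≤ C ∧ ∀ (m : Fin n → ℕ) (x : ∀ k, Fin (m k) → E k),
    (∑ j : ∀ k, Fin (m k), ‖A (fun k => x k (j k))‖ ^ q) ^ (1 / q) ≤
      C * ∏ k, weakLpNorm 𝕜 (p k) (x k)

/-- The class `Π_p^n(E₁, …, Eₙ; F)` of multiple `p`-summing (i.e. multiple `(p; p, …, p)`-summing)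
continuous `n`-linear maps. -/
def multipleSummingMaps (𝕜 : Type*) [RCLike 𝕜] {n : ℕ} (p : ℝ) (E : Fin n → Type*) (F : Type*)
    [∀ k, NormedAddCommGroup (E k)] [∀ k, NormedSpace 𝕜 (E k)]
    [NormedAddCommGroup F] [NormedSpace 𝕜 F] : Set (ContinuousMultilinearMap 𝕜 E F) :=
  {A | IsMultipleSumming p (fun _ => p) A}

end

/-!
The theorem rests on the factorization `ℓ₁ʷ(E) = ℓ₂ · ℓ₂ʷ(E)` for a space `E` of cotype 2
(`HasCotype.exists_factorization`): every finite family in `E` is `xⱼ = aⱼ yⱼ` with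
`∑ aⱼ² ≤ 1` and `‖y‖_{w,2} ≤ K ‖x‖_{w,1}`, where `K` depends on `E` only. Given it, multilinearity
turns `∑ ‖A(x)‖` into `∑ (∏ₖ aₖ) ‖A(y)‖`, and the Cauchy–Schwarz inequality bounds this by
`(∑ ‖A(y)‖²) ^ (1/2)`, to which the multiple 2-summability of `A` applies.

The factorization says that the operator `u : ℓ_∞^m → E`, `u z = ∑ zⱼ xⱼ`, satisfies
`‖u z‖² ≤ K² ∑ λⱼ |zⱼ|²` for some probability vector `λ` with `K` at most a multiple of
`W = ‖x‖_{w,1}` (`IsPietschWeight`); then `aⱼ = √λⱼ` and `yⱼ = xⱼ / √λⱼ`. Maurey's theorem that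
operators from `ℓ_∞^m` into a space of cotype 2 are 2-summing with a uniform constant is obtained
here by a bootstrap. Some `K` always works, by finiteness of `m`. If `K` works, then so
does `√(8 C² W K)`, with `C` the cotype constant (`IsPietschWeight.improve`). Comparing with the
infimum of the admissible `K` gives `K ≤ 16 C² W`.

For the improvement, let `∑ᵢ |zⁱⱼ|² ≤ s` for all `j`. Cotype 2 bounds `∑ᵢ ‖u zⁱ‖²` by the average
of `C² ‖u (∑ᵢ εᵢ zⁱ)‖²` over signs. Truncating the vector `Z = ∑ᵢ εᵢ zⁱ` at height `t`, with the
operator bound `W` on the small part and `λ` on the large one, gives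
`‖u Z‖² ≤ 2 W² t² + 2 (K² / t²) ∑ λⱼ |Zⱼ|⁴`. The fourth moments are controlled by Khinchin's
inequality, and `t² = K s / W` balances the terms. The 2-summing inequality so obtained yields a new
probability vector by Hahn–Banach separation (`IsPietschWeight.of_two_summing`).
-/

open Finset

/-! ### Second and fourth moments of Rademacher sums -/

theorem norm_add_sq_add_norm_sub_sq {𝕜 : Type*} [RCLike 𝕜] (s a : 𝕜) :
    ‖s + a‖ ^ 2 + ‖s - a‖ ^ 2 = 2 * (‖s‖ ^ 2 + ‖a‖ ^ 2) := by
  have := parallelogram_law_with_norm ℝ s a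
  nlinarith

theorem norm_add_pow_four_add_norm_sub_pow_four_le {𝕜 : Type*} [RCLike 𝕜] (s a : 𝕜) :
    ‖s + a‖ ^ 4 + ‖s - a‖ ^ 4 ≤ 2 * (‖s‖ ^ 4 + 6 * (‖s‖ ^ 2 * ‖a‖ ^ 2) + ‖a‖ ^ 4) := by
  have h1 := norm_add_sq_real s a
  have h2 := norm_sub_sq_real s a
  have h3 : (inner ℝ s a : ℝ) ^ 2 ≤ ‖s‖ ^ 2 * ‖a‖ ^ 2 := by
    rw [← mul_pow, ← sq_abs]
    exact pow_le_pow_left₀ (abs_nonneg _) (abs_real_inner_le_norm s a) 2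
  have h4 : ‖s + a‖ ^ 4 = (‖s + a‖ ^ 2) ^ 2 := by ring
  have h5 : ‖s - a‖ ^ 4 = (‖s - a‖ ^ 2) ^ 2 := by ring
  rw [h4, h5, h1, h2]
  nlinarith

/-- Splitting off the sign of the first vector in a sum over all choices of signs. -/
theorem sum_signs_succ {M : Type*} [AddCommGroup M] {N : ℕ} (f : M → ℝ) (a : Fin (N + 1) → M) :
    ∑ ε : Fin (N + 1) → ℤˣ, f (∑ i, ((ε i : ℤˣ) : ℤ) • a i) =
      ∑ ε : Fin N → ℤˣ, (f (∑ i, ((ε i : ℤˣ) : ℤ) • a i.succ + a 0) +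
        f (∑ i, ((ε i : ℤˣ) : ℤ) • a i.succ - a 0)) := by
  rw [← (Fin.consEquiv fun _ : Fin (N + 1) => ℤˣ).sum_comp, Fintype.sum_prod_type_right]
  refine sum_congr rfl fun ε _ => ?_
  rw [show (univ : Finset ℤˣ) = {1, -1} from rfl, sum_pair (by decide)]
  simp [Fin.consEquiv, Fin.sum_univ_succ, add_comm, sub_eq_add_neg]

theorem sum_signs_norm_sq {𝕜 : Type*} [RCLike 𝕜] {N : ℕ} (a : Fin N → 𝕜) :
    ∑ ε : Fin N → ℤˣ, ‖∑ i, ((ε i : ℤˣ) : ℤ) • a i‖ ^ 2 = 2 ^ N * ∑ i, ‖a i‖ ^ 2 := by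
  induction N with
  | zero => simp
  | succ N ih =>
    rw [sum_signs_succ (fun v => ‖v‖ ^ 2) a]
    simp_rw [norm_add_sq_add_norm_sub_sq]
    rw [← mul_sum, sum_add_distrib, ih fun i => a i.succ, Fin.sum_univ_succ]
    simp
    ring

/-- Khinchin's inequality for the fourth moment of a scalar Rademacher sum, with constant `3`. -/
theorem sum_signs_norm_pow_four_le {𝕜 : Type*} [RCLike 𝕜] {N : ℕ} (a : Fin N → 𝕜) :
    ∑ ε : Fin N → ℤˣ, ‖∑ i, ((ε i : ℤˣ) : ℤ) • a i‖ ^ 4 ≤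
      2 ^ N * (3 * (∑ i, ‖a i‖ ^ 2) ^ 2) := by
  induction N with
  | zero => simp
  | succ N ih =>
    rw [sum_signs_succ (fun v => ‖v‖ ^ 4) a]
    refine (sum_le_sum fun ε _ => norm_add_pow_four_add_norm_sub_pow_four_le _ _).trans ?_
    have h := ih fun i => a i.succ
    have h2 := sum_signs_norm_sq fun i => a i.succ
    rw [← mul_sum, sum_add_distrib, sum_add_distrib, ← mul_sum, ← sum_mul, h2, Fin.sum_univ_succ]
    simp only [sum_const, card_univ, Fintype.card_pi, Fintype.card_units_int, prod_const,
      Fintype.card_fin, nsmul_eq_mul, Nat.cast_pow, Nat.cast_ofNat]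
    have h3 : (0 : ℝ) ≤ 2 ^ N * (‖a 0‖ ^ 4) := by positivity
    rw [pow_succ (2 : ℝ)]
    nlinarith

/-! ### Pietsch weights -/

/-- The probability vector `lam` is a Pietsch measure, with constant `K`, for the operator
`z ↦ ∑ zⱼ xⱼ` from `ℓ_∞^ι` to `E`, i.e. this operator extends to `ℓ₂(lam)` with norm at most `|K|`.
Only the squares `K ^ 2` enter, so no sign condition is put on `K`. -/
def IsPietschWeight (𝕜 : Type*) [RCLike 𝕜] {ι E : Type*} [Fintype ι] [NormedAddCommGroup E]
    [NormedSpace 𝕜 E] (x : ι → E) (K : ℝ) (lam : ι → ℝ) : Prop :=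
  (∀ j, 0 ≤ lam j) ∧ ∑ j, lam j = 1 ∧
    ∀ z : ι → 𝕜, ‖∑ j, z j • x j‖ ^ 2 ≤ K ^ 2 * ∑ j, lam j * ‖z j‖ ^ 2

section

variable {𝕜 : Type*} [RCLike 𝕜] {ι E : Type*} [Fintype ι] [NormedAddCommGroup E] [NormedSpace 𝕜 E]

/-- A finite family has the uniform weight as a Pietsch weight, with a constant that depends on the
family. -/
theorem exists_isPietschWeight [Nonempty ι] (x : ι → E) :
    ∃ K > 0, ∃ lam, IsPietschWeight 𝕜 x K lam := by
  have hcard : (0 : ℝ) < Fintype.card ι := by exact_mod_cast Fintype.card_pos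
  have hpos : 0 < Fintype.card ι * (∑ j, ‖x j‖ ^ 2 + 1) :=
    mul_pos hcard (by positivity)
  refine ⟨√(Fintype.card ι * (∑ j, ‖x j‖ ^ 2 + 1)), Real.sqrt_pos.2 hpos,
    fun _ => (Fintype.card ι : ℝ)⁻¹, fun _ => by positivity, ?_, fun z => ?_⟩
  · simp [hcard.ne']
  · rw [Real.sq_sqrt hpos.le, ← mul_sum]
    calc ‖∑ j, z j • x j‖ ^ 2 ≤ (∑ j, ‖z j‖ * ‖x j‖) ^ 2 := by
          gcongr
          exact norm_sum_le_of_le _ fun j _ => (norm_smul _ _).le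
      _ ≤ (∑ j, ‖z j‖ ^ 2) * ∑ j, ‖x j‖ ^ 2 := sum_mul_sq_le_sq_mul_sq _ _ _
      _ ≤ (∑ j, ‖z j‖ ^ 2) * (∑ j, ‖x j‖ ^ 2 + 1) := by gcongr; linarith
      _ = _ := by field_simp

/-- The Pietsch domination theorem for operators on `ℓ_∞^ι`: if `z ↦ ∑ zⱼ xⱼ` is 2-summing with
constant `K`, then it has a Pietsch weight with constant `K`. -/
theorem IsPietschWeight.of_two_summing [Nonempty ι] {x : ι → E} {K : ℝ} (hK : 0 < K)
    (h : ∀ (N : ℕ) (z : Fin N → ι → 𝕜) (s : ℝ), 0 < s → (∀ j, ∑ i, ‖z i j‖ ^ 2 ≤ s) →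
      ∑ i, ‖∑ j, z i j • x j‖ ^ 2 ≤ K ^ 2 * s) :
    ∃ lam, IsPietschWeight 𝕜 x K lam := by
  classical
  -- The weight is a functional separating the open negative orthant from the convex hull of the
  -- vectors `b z`.
  let b : (ι → 𝕜) → ι → ℝ := fun z j => K ^ 2 * ‖z j‖ ^ 2 - ‖∑ j, z j • x j‖ ^ 2
  let S : Set (ι → ℝ) := {v | ∀ j, v j < 0}
  have hS : S = Set.univ.pi fun _ => Set.Iio 0 := by ext; simp [S]
  have hdisj : Disjoint S (convexHull ℝ (Set.range b)) := by
    rw [Set.disjoint_left]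
    intro v hv hv'
    obtain ⟨κ, _, w, y, hw, -, hy, rfl⟩ := mem_convexHull_iff_exists_fintype.1 hv'
    choose z hz using hy
    -- A convex combination of the `b (z i)` with weights `w i` comes from the family `√(w i) z i`.
    obtain ⟨j₀, -, hj₀⟩ := exists_max_image univ (fun j => ∑ i, w i * ‖z i j‖ ^ 2) univ_nonempty
    set T := ∑ i, w i * ‖∑ j, z i j • x j‖ ^ 2 with hT
    set r := ∑ i, w i * ‖z i j₀‖ ^ 2 with hr
    have hr0 : 0 ≤ r := sum_nonneg fun i _ => mul_nonneg (hw i) (by positivity)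
    have hlt : K ^ 2 * r < T := by
      have := hv j₀
      simp only [← hz, b, Finset.sum_apply, Pi.smul_apply, smul_eq_mul, mul_sub,
        sum_sub_distrib] at this
      rw [hr, hT, mul_sum]
      simp only [mul_left_comm (K ^ 2)]
      linarith
    have hK2 : 0 < K ^ 2 := by positivity
    have hrs : r < T / K ^ 2 := by rwa [lt_div_iff₀ hK2, mul_comm]
    let e := Fintype.equivFin κ
    -- The midpoint of `r` and `T / K ^ 2` is positive even if `r = 0`, and still below `T / K ^ 2`.
    have key := h (Fintype.card κ) (fun i j => ((√(w (e.symm i)) : ℝ) : 𝕜) * z (e.symm i) j)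
      ((r + T / K ^ 2) / 2) (by linarith) fun j => by
        rw [e.symm.sum_comp fun i => ‖((√(w i) : ℝ) : 𝕜) * z i j‖ ^ 2]
        simp only [norm_mul, mul_pow, RCLike.norm_ofReal, sq_abs, Real.sq_sqrt (hw _)]
        have := hj₀ j (mem_univ _)
        linarith
    rw [e.symm.sum_comp fun i => ‖∑ j, (((√(w i) : ℝ) : 𝕜) * z i j) • x j‖ ^ 2] at key
    simp only [mul_smul, ← smul_sum, norm_smul, mul_pow, RCLike.norm_ofReal, sq_abs,
      Real.sq_sqrt (hw _)] at key
    rw [← hT] at key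
    have : K ^ 2 * ((r + T / K ^ 2) / 2) = (K ^ 2 * r + T) / 2 := by field_simp
    linarith
  obtain ⟨f, u, hfS, hfT⟩ := geometric_hahn_banach_open
    (hS ▸ convex_pi fun _ _ => convex_Iio 0)
    (hS ▸ isOpen_set_pi Set.finite_univ fun _ _ => isOpen_Iio)
    (convex_convexHull ℝ (Set.range b)) hdisj
  have hu0 : u ≤ 0 := by
    have hb : b 0 = 0 := by ext; simp [b]
    simpa [hb] using hfT (b 0) (subset_convexHull ℝ _ ⟨0, rfl⟩)
  have hf : ∀ v, f v = ∑ j, v j * f (Pi.single j 1) := fun v => by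
    conv_lhs => rw [pi_eq_sum_univ' v]
    simp [map_sum]
  set c : ι → ℝ := fun j => f (Pi.single j 1) with hc
  set t := ∑ j, c j with ht
  have hconst : ∀ δ : ℝ, 0 < δ → -δ * t < u := fun δ hδ => by
    have := hfS (fun _ => -δ) fun _ => by simpa using hδ
    rwa [hf, ← mul_sum] at this
  have ht0 : 0 < t := by linarith [hconst 1 one_pos]
  have hu : 0 ≤ u := by
    by_contra! hneg
    have := hconst (-u / t) (div_pos (by linarith) ht0)
    rw [show -(-u / t) * t = u by field_simp] at this
    exact this.false
  have hc0 : ∀ j, 0 ≤ c j := fun j => by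
    by_contra! hneg
    have := hfS (fun i => -(-c j / t) - (Pi.single j 1 : ι → ℝ) i) fun i => by
      have h1 : 0 < -c j / t := div_pos (by linarith) ht0
      have h2 : (0 : ℝ) ≤ (Pi.single j 1 : ι → ℝ) i := by
        by_cases hij : i = j
        · subst hij; simp
        · simp [hij]
      linarith
    rw [hf] at this
    simp only [sub_mul, sum_sub_distrib, ← mul_sum, Pi.single_apply, ite_mul, one_mul, zero_mul,
      sum_ite_eq', mem_univ, if_true] at this
    have h3 : -(-c j / t) * t = c j := by field_simp
    change -(-c j / t) * t - c j < u at this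
    linarith
  refine ⟨fun j => c j / t, fun j => div_nonneg (hc0 j) ht0.le, ?_, fun z => ?_⟩
  · rw [← sum_div, div_self ht0.ne']
  · have := hfT (b z) (subset_convexHull ℝ _ ⟨z, rfl⟩)
    rw [hf] at this
    simp only [b, sub_mul, sum_sub_distrib, ← mul_sum] at this
    change u ≤ _ - _ * t at this
    have h1 : ∑ j, c j / t * ‖z j‖ ^ 2 = (∑ j, c j * ‖z j‖ ^ 2) / t := by
      rw [sum_div]; exact sum_congr rfl fun j _ => by ring
    have h2 : ∑ j, K ^ 2 * ‖z j‖ ^ 2 * c j = K ^ 2 * ∑ j, c j * ‖z j‖ ^ 2 := by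
      rw [mul_sum]; exact sum_congr rfl fun j _ => by ring
    rw [h1, ← mul_div_assoc, le_div_iff₀ ht0, ← h2]
    change u ≤ ∑ j, K ^ 2 * ‖z j‖ ^ 2 * c j - _ at this
    linarith

/-! ### Operators from `ℓ_∞` into spaces of cotype 2 -/

/-- The part of `z` below the height `t` is estimated in `ℓ_∞`, the part above it in `ℓ₂(lam)`. -/
theorem IsPietschWeight.norm_sq_le_of_truncation {x : ι → E} {K W t : ℝ} {lam : ι → ℝ}
    (hlam : IsPietschWeight 𝕜 x K lam)
    (hW : ∀ (z : ι → 𝕜) (s : ℝ), 0 ≤ s → (∀ j, ‖z j‖ ≤ s) → ‖∑ j, z j • x j‖ ≤ s * W)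
    (ht : 0 < t) (z : ι → 𝕜) :
    ‖∑ j, z j • x j‖ ^ 2 ≤
      2 * W ^ 2 * t ^ 2 + 2 * (K ^ 2 / t ^ 2) * ∑ j, lam j * ‖z j‖ ^ 4 := by
  let z₁ : ι → 𝕜 := fun j => if ‖z j‖ ≤ t then z j else 0
  let z₂ : ι → 𝕜 := fun j => if ‖z j‖ ≤ t then 0 else z j
  have hsum : ∑ j, z j • x j = ∑ j, z₁ j • x j + ∑ j, z₂ j • x j := by
    rw [← sum_add_distrib]
    refine sum_congr rfl fun j _ => ?_
    by_cases h : ‖z j‖ ≤ t <;> simp [z₁, z₂, h]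
  have h₁ : ‖∑ j, z₁ j • x j‖ ≤ t * W := hW _ _ ht.le fun j => by
    by_cases h : ‖z j‖ ≤ t <;> simp [z₁, h, ht.le]
  have h₂ : ‖∑ j, z₂ j • x j‖ ^ 2 ≤ K ^ 2 / t ^ 2 * ∑ j, lam j * ‖z j‖ ^ 4 := by
    refine (hlam.2.2 z₂).trans ?_
    rw [div_mul_eq_mul_div, mul_div_assoc, sum_div]
    gcongr with j
    rw [mul_div_assoc]
    refine mul_le_mul_of_nonneg_left ?_ (hlam.1 j)
    by_cases h : ‖z j‖ ≤ t
    · rw [show z₂ j = 0 from if_pos h, norm_zero, zero_pow two_ne_zero]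
      positivity
    · simp only [z₂, h, if_false]
      rw [le_div_iff₀ (by positivity)]
      have : ‖z j‖ ^ 4 = ‖z j‖ ^ 2 * ‖z j‖ ^ 2 := by ring
      rw [this]
      gcongr
      exact (not_le.1 h).le
  have h₁' : ‖∑ j, z₁ j • x j‖ ^ 2 ≤ (t * W) ^ 2 := by gcongr
  have htri : ‖∑ j, z j • x j‖ ^ 2 ≤ (‖∑ j, z₁ j • x j‖ + ‖∑ j, z₂ j • x j‖) ^ 2 := by
    rw [hsum]; gcongr; exact norm_add_le _ _
  nlinarith [sq_nonneg (‖∑ j, z₁ j • x j‖ - ‖∑ j, z₂ j • x j‖)]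

/-- The bootstrap step: if `E` has cotype 2 with constant `C` and `z ↦ ∑ zⱼ xⱼ` has norm at most `W`
on `ℓ_∞^ι`, then a Pietsch constant `K` may be replaced by a multiple of the geometric mean of `W`
and `K`. -/
theorem IsPietschWeight.improve [Nonempty ι] {x : ι → E} {K W C : ℝ} {lam : ι → ℝ}
    (hK : 0 < K) (hW0 : 0 < W) (hC : 0 < C) (hlam : IsPietschWeight 𝕜 x K lam)
    (hW : ∀ (z : ι → 𝕜) (s : ℝ), 0 ≤ s → (∀ j, ‖z j‖ ≤ s) → ‖∑ j, z j • x j‖ ≤ s * W)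
    (hcot : ∀ (N : ℕ) (v : Fin N → E), ∑ i, ‖v i‖ ^ 2 ≤
      C ^ 2 * ((∑ ε : Fin N → ℤˣ, ‖∑ i, ((ε i : ℤˣ) : ℤ) • v i‖ ^ 2) / 2 ^ N)) :
    ∃ lam', IsPietschWeight 𝕜 x (√(8 * C ^ 2 * W * K)) lam' := by
  refine IsPietschWeight.of_two_summing (by positivity) fun N z s hs hz => ?_
  rw [Real.sq_sqrt (by positivity)]
  refine (hcot N _).trans ?_
  -- The truncation height is `√(K * s / W)`, which makes both error terms multiples of `W * K * s`.
  have ht : 0 < K * s / W := by positivity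
  have ht2 : √(K * s / W) ^ 2 = K * s / W := Real.sq_sqrt ht.le
  have hε : ∀ ε : Fin N → ℤˣ, ‖∑ i, ((ε i : ℤˣ) : ℤ) • ∑ j, z i j • x j‖ ^ 2 ≤
      2 * W ^ 2 * (K * s / W) + 2 * (K ^ 2 / (K * s / W)) *
        ∑ j, lam j * ‖∑ i, ((ε i : ℤˣ) : ℤ) • z i j‖ ^ 4 := fun ε => by
    have := hlam.norm_sq_le_of_truncation hW (Real.sqrt_pos.2 ht)
      fun j => ∑ i, ((ε i : ℤˣ) : ℤ) • z i j
    rw [ht2] at this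
    convert this using 3
    simp only [smul_sum, sum_smul, smul_assoc]
    rw [sum_comm]
  have hmom : ∑ ε : Fin N → ℤˣ, ∑ j, lam j * ‖∑ i, ((ε i : ℤˣ) : ℤ) • z i j‖ ^ 4 ≤
      2 ^ N * (3 * s ^ 2) := by
    rw [sum_comm]
    calc _ ≤ ∑ j, lam j * (2 ^ N * (3 * s ^ 2)) := by
          refine sum_le_sum fun j _ => ?_
          rw [← mul_sum]
          refine mul_le_mul_of_nonneg_left ?_ (hlam.1 j)
          refine (sum_signs_norm_pow_four_le fun i => z i j).trans ?_
          gcongr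
          exact hz j
      _ = _ := by rw [← sum_mul, hlam.2.1, one_mul]
  have hsum : ∑ ε : Fin N → ℤˣ, ‖∑ i, ((ε i : ℤˣ) : ℤ) • ∑ j, z i j • x j‖ ^ 2 ≤
      2 ^ N * (8 * W * K * s) := by
    calc _ ≤ ∑ ε : Fin N → ℤˣ, (2 * W ^ 2 * (K * s / W) + 2 * (K ^ 2 / (K * s / W)) *
        ∑ j, lam j * ‖∑ i, ((ε i : ℤˣ) : ℤ) • z i j‖ ^ 4) := sum_le_sum fun ε _ => hε ε
      _ ≤ 2 ^ N * (2 * W ^ 2 * (K * s / W)) + 2 * (K ^ 2 / (K * s / W)) *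
          (2 ^ N * (3 * s ^ 2)) := by
        rw [sum_add_distrib]
        refine add_le_add (by simp) ?_
        rw [← mul_sum]
        gcongr
      _ = _ := by field_simp; ring
  calc _ ≤ C ^ 2 * (2 ^ N * (8 * W * K * s) / 2 ^ N) := by gcongr
    _ = _ := by field_simp

/-- An operator of norm at most `W` from `ℓ_∞^ι` into a space of cotype 2 has a Pietsch weight with
constant `16 * C ^ 2 * W`, independent of the size of `ι`. -/
theorem exists_isPietschWeight_of_cotype [Nonempty ι] {x : ι → E} {W C : ℝ}
    (hW0 : 0 < W) (hC : 0 < C)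
    (hW : ∀ (z : ι → 𝕜) (s : ℝ), 0 ≤ s → (∀ j, ‖z j‖ ≤ s) → ‖∑ j, z j • x j‖ ≤ s * W)
    (hcot : ∀ (N : ℕ) (v : Fin N → E), ∑ i, ‖v i‖ ^ 2 ≤
      C ^ 2 * ((∑ ε : Fin N → ℤˣ, ‖∑ i, ((ε i : ℤˣ) : ℤ) • v i‖ ^ 2) / 2 ^ N)) :
    ∃ K, 0 < K ∧ K ≤ 16 * C ^ 2 * W ∧ ∃ lam, IsPietschWeight 𝕜 x K lam := by
  set S : Set ℝ := {K | 0 < K ∧ ∃ lam, IsPietschWeight 𝕜 x K lam} with hS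
  have hne : S.Nonempty := by
    obtain ⟨K, hK, h⟩ := exists_isPietschWeight (𝕜 := 𝕜) x
    exact ⟨K, hK, h⟩
  have hbdd : BddBelow S := ⟨0, fun K hK => hK.1.le⟩
  have hM : 0 < 16 * C ^ 2 * W := by positivity
  suffices h : sInf S < 16 * C ^ 2 * W by
    obtain ⟨K, hK, hlt⟩ := exists_lt_of_csInf_lt hne h
    exact ⟨K, hK.1, hlt.le, hK.2⟩
  -- Otherwise the bootstrap, applied to some admissible `K < 2 * sInf S`, leads below `sInf S`.
  by_contra! hge
  have hpos : 0 < sInf S := hM.trans_le hge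
  obtain ⟨K, ⟨hK, lam, hlam⟩, hlt⟩ :=
    exists_lt_of_csInf_lt hne (show sInf S < 2 * sInf S by linarith)
  have hmem : √(8 * C ^ 2 * W * K) ∈ S :=
    ⟨by positivity, hlam.improve hK hW0 hC hW hcot⟩
  have h1 : sInf S ≤ √(8 * C ^ 2 * W * K) := csInf_le hbdd hmem
  have h2 : √(8 * C ^ 2 * W * K) < sInf S := by
    rw [Real.sqrt_lt' hpos]
    nlinarith [mul_pos hM hK]
  linarith

/-! ### Weak norms and the factorization of weakly summable families -/

theorem bddAbove_weakLpNorm {m : ℕ} {p : ℝ} (hp : 0 ≤ p) (x : Fin m → E) :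
    BddAbove (Set.range fun φ : {φ : StrongDual 𝕜 E // ‖φ‖ ≤ 1} =>
      (∑ j, ‖φ.1 (x j)‖ ^ p) ^ (1 / p)) := by
  refine ⟨(∑ j, ‖x j‖ ^ p) ^ (1 / p), ?_⟩
  rintro _ ⟨φ, rfl⟩
  dsimp only
  gcongr with j
  exact φ.1.le_of_opNorm_le φ.2 (x j) |>.trans_eq (one_mul _)

theorem weakLpNorm_nonneg {m : ℕ} (p : ℝ) (x : Fin m → E) : 0 ≤ weakLpNorm 𝕜 p x :=
  Real.iSup_nonneg fun _ => by positivity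

/-- The operator `z ↦ ∑ zⱼ xⱼ` on `ℓ_∞^m` has norm at most `‖x‖_{w,1}`. -/
theorem norm_sum_smul_le_weakLpNorm_one {m : ℕ} (x : Fin m → E) (z : Fin m → 𝕜) {s : ℝ}
    (hs : 0 ≤ s) (hz : ∀ j, ‖z j‖ ≤ s) : ‖∑ j, z j • x j‖ ≤ s * weakLpNorm 𝕜 1 x := by
  obtain ⟨φ, hφ, hφx⟩ := exists_dual_vector'' 𝕜 (∑ j, z j • x j)
  have h1 : ∑ j, ‖φ (x j)‖ ≤ weakLpNorm 𝕜 1 x := by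
    simpa [weakLpNorm] using le_ciSup (bddAbove_weakLpNorm (𝕜 := 𝕜) zero_le_one x) ⟨φ, hφ⟩
  calc ‖∑ j, z j • x j‖ = ‖φ (∑ j, z j • x j)‖ := by rw [hφx]; simp
    _ ≤ ∑ j, s * ‖φ (x j)‖ := by
      simp only [map_sum, map_smul, smul_eq_mul]
      refine norm_sum_le_of_le _ fun j _ => ?_
      rw [norm_mul]
      gcongr
      exact hz j
    _ ≤ s * weakLpNorm 𝕜 1 x := by rw [← mul_sum]; gcongr

/-- `‖y‖_{w,2}` is at most the norm of the operator `z ↦ ∑ zⱼ yⱼ` on `ℓ₂^m`. -/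
theorem weakLpNorm_two_le {m : ℕ} {y : Fin m → E} {K : ℝ} (hK : 0 ≤ K)
    (h : ∀ z : Fin m → 𝕜, ‖∑ j, z j • y j‖ ^ 2 ≤ K ^ 2 * ∑ j, ‖z j‖ ^ 2) :
    weakLpNorm 𝕜 2 y ≤ K := by
  refine Real.iSup_le (fun φ => ?_) hK
  rw [← Real.sqrt_eq_rpow, Real.sqrt_le_left hK]
  simp only [Real.rpow_ofNat]
  set S := ∑ j, ‖φ.1 (y j)‖ ^ 2 with hS
  -- Test the hypothesis on the conjugates `zⱼ` of `φ yⱼ`.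
  have hφ : φ.1 (∑ j, star (φ.1 (y j)) • y j) = (S : 𝕜) := by
    simp [hS, RCLike.conj_mul]
  have hS0 : 0 ≤ S := by positivity
  have h1 : S ^ 2 ≤ K ^ 2 * S := by
    calc S ^ 2 = ‖φ.1 (∑ j, star (φ.1 (y j)) • y j)‖ ^ 2 := by rw [hφ]; simp
      _ ≤ ‖∑ j, star (φ.1 (y j)) • y j‖ ^ 2 := by
        gcongr
        exact φ.1.le_of_opNorm_le φ.2 _ |>.trans_eq (one_mul _)
      _ ≤ _ := by simpa [hS] using h fun j => star (φ.1 (y j))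
  by_contra! hlt
  nlinarith [sq_nonneg K]

/-- Cotype 2 without roots and real exponents, and with a strictly positive constant. -/
theorem HasCotype.exists_pos_sum_sq_le (h : HasCotype 2 E) :
    ∃ C > 0, ∀ (N : ℕ) (v : Fin N → E), ∑ i, ‖v i‖ ^ 2 ≤
      C ^ 2 * ((∑ ε : Fin N → ℤˣ, ‖∑ i, ((ε i : ℤˣ) : ℤ) • v i‖ ^ 2) / 2 ^ N) := by
  obtain ⟨C, hC, h⟩ := h
  refine ⟨C + 1, by positivity, fun N v => ?_⟩
  have := h N v
  simp only [← Real.sqrt_eq_rpow, Real.rpow_ofNat] at this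
  rw [Real.sqrt_le_left (by positivity), mul_pow, Real.sq_sqrt (by positivity)] at this
  refine this.trans ?_
  gcongr
  linarith

/-- In a space of cotype 2, a weakly 1-summable family is the product of a 2-summable scalar family
and a weakly 2-summable family. -/
theorem HasCotype.exists_factorization (h : HasCotype 2 E) :
    ∃ K : ℝ, 0 ≤ K ∧ ∀ (m : ℕ) (x : Fin m → E), ∃ (a : Fin m → ℝ) (y : Fin m → E),
      (∀ j, 0 ≤ a j) ∧ ∑ j, a j ^ 2 ≤ 1 ∧ (∀ j, x j = (a j : 𝕜) • y j) ∧
        weakLpNorm 𝕜 2 y ≤ K * weakLpNorm 𝕜 1 x := by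
  obtain ⟨C, hC, hcot⟩ := h.exists_pos_sum_sq_le
  refine ⟨16 * C ^ 2, by positivity, fun m x => ?_⟩
  rcases (weakLpNorm_nonneg (𝕜 := 𝕜) 1 x).eq_or_lt with hW | hW
  · have hx : ∀ j, x j = 0 := fun j => by
      have := norm_sum_smul_le_weakLpNorm_one (𝕜 := 𝕜) x (Pi.single j 1) zero_le_one fun i => by
        by_cases hij : i = j
        · subst hij; simp
        · simp [hij]
      rw [← hW] at this
      simpa [Pi.single_apply] using this
    refine ⟨0, 0, by simp, by simp, by simpa using hx, ?_⟩
    rw [← hW, mul_zero]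
    exact weakLpNorm_two_le le_rfl (by simp)
  rcases isEmpty_or_nonempty (Fin m) with hm | hm
  · refine ⟨0, 0, by simp, by simp, fun j => hm.elim j, weakLpNorm_two_le (by positivity) ?_⟩
    simp
  obtain ⟨K, hK, hKle, lam, hlam0, hlam1, hlam⟩ := exists_isPietschWeight_of_cotype (𝕜 := 𝕜) hW hC
    (fun z s hs hz => norm_sum_smul_le_weakLpNorm_one x z hs hz) hcot
  -- Where `lam j = 0`, the vector `x j` vanishes, so the value `(√0)⁻¹ = 0` below is harmless.
  have hx0 : ∀ j, lam j = 0 → x j = 0 := fun j hj => by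
    have := hlam (Pi.single j 1)
    have h0 : ∀ i, lam i * ‖(Pi.single j 1 : Fin m → 𝕜) i‖ ^ 2 = 0 := fun i => by
      by_cases hij : i = j
      · subst hij; simp [hj]
      · simp [hij]
    simp only [h0, sum_const_zero, mul_zero] at this
    simpa [Pi.single_apply] using this
  refine ⟨fun j => √(lam j), fun j => ((√(lam j))⁻¹ : 𝕜) • x j, fun j => Real.sqrt_nonneg _, ?_,
    fun j => ?_, (weakLpNorm_two_le hK.le fun z => ?_).trans hKle⟩
  · simp [Real.sq_sqrt (hlam0 _), hlam1]
  · by_cases hj : lam j = 0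
    · simp [hx0 j hj]
    · have : ((√(lam j) : ℝ) : 𝕜) ≠ 0 := by
        simpa using (Real.sqrt_pos.2 ((hlam0 j).lt_of_ne' hj)).ne'
      rw [smul_smul, mul_inv_cancel₀ this, one_smul]
  · simp only [smul_smul]
    refine (hlam _).trans ?_
    gcongr with j
    by_cases hj : lam j = 0
    · simp [hj]
    · rw [norm_mul, mul_pow, norm_inv, RCLike.norm_ofReal, inv_pow, sq_abs, Real.sq_sqrt (hlam0 j)]
      exact le_of_eq (by field_simp)

end

/-! ### Inclusion of multiple summing maps -/

theorem mainTheorem1 {𝕜 : Type*} [RCLike 𝕜] (n : ℕ) (hn : 0 < n)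
    (E : Fin n → Type*) [∀ k, NormedAddCommGroup (E k)] [∀ k, NormedSpace 𝕜 (E k)]
    [∀ k, CompleteSpace (E k)]
    (F : Type*) [NormedAddCommGroup F] [NormedSpace 𝕜 F] [CompleteSpace F]
    (hE : ∀ k, HasCotype 2 (E k)) :
    multipleSummingMaps 𝕜 2 E F ⊆ multipleSummingMaps 𝕜 1 E F := by
  rintro A ⟨C, hC, hA⟩
  choose K hK hfac using fun k => (hE k).exists_factorization (𝕜 := 𝕜)
  refine ⟨C * ∏ k, K k, mul_nonneg hC (prod_nonneg fun k _ => hK k), fun m x => ?_⟩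
  choose a y ha0 ha1 hxy hy using fun k => hfac k (m k) (x k)
  have hA2 := hA m y
  simp only [← Real.sqrt_eq_rpow, Real.rpow_ofNat] at hA2
  simp only [Real.rpow_one, div_one]
  have hprod : ∑ j : ∀ k, Fin (m k), (∏ k, a k (j k)) ^ 2 ≤ 1 := by
    simp only [← prod_pow]
    rw [← Fintype.prod_sum fun k i => a k i ^ 2]
    exact prod_le_one (fun k _ => by positivity) fun k _ => ha1 k
  calc ∑ j : ∀ k, Fin (m k), ‖A fun k => x k (j k)‖
      = ∑ j : ∀ k, Fin (m k), (∏ k, a k (j k)) * ‖A fun k => y k (j k)‖ := by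
        refine sum_congr rfl fun j _ => ?_
        simp only [hxy]
        rw [A.map_smul_univ fun k => ((a k (j k) : ℝ) : 𝕜), norm_smul, norm_prod]
        simp [abs_of_nonneg (ha0 _ _)]
    _ ≤ √(∑ j : ∀ k, Fin (m k), (∏ k, a k (j k)) ^ 2) *
          √(∑ j : ∀ k, Fin (m k), ‖A fun k => y k (j k)‖ ^ 2) :=
        Real.sum_mul_le_sqrt_mul_sqrt _ _ _
    _ ≤ 1 * (C * ∏ k, weakLpNorm 𝕜 2 (y k)) := by
        gcongr
        exact Real.sqrt_le_one.2 hprod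
    _ ≤ C * ∏ k, (K k * weakLpNorm 𝕜 1 (x k)) := by
        rw [one_mul]
        gcongr with k
        · exact fun k _ => weakLpNorm_nonneg _ _
        · exact hy k
    _ = (C * ∏ k, K k) * ∏ k, weakLpNorm 𝕜 1 (x k) := by rw [prod_mul_distrib, mul_assoc]
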